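/- **Setting.** Let $0<k<n$ be integers and $J=\{1,\dots,n\}$. Let $g_j=b_j^1t_1+\dots+b_j^kt_k$, $j\in J$, be nonzero linear functions with integer coefficients $b_j^i$ that span the $k$-dimensional space of linear functions on $\mathbb C^k$, and put $f_j=z_j+g_j$. Let $\mathfrak C$ be the set of circuits $C\subset J$ (minimal subsets with $(g_j)_{j\in C}$ linearly dependent over $\mathbb C$). For $C\in\mathfrak C$ fix integers $(\lambda_C^i)_{i\in J}$ with greatest common divisor $1$, with $\lambda_C^i=0$ for $i\notin C$ and $\sum_i\lambda_C^ig_i=0$ (they are unique up to a common sign), and put $f_C=\sum_i\lambda_C^iz_i$. Let $[\,\cdot\,]$ denote reduction modulo a prime $p$. The prime $p$ is *good* with respect to $(g_j)_{j\in J}$ if all the reductions $[g]_j,[f]_j,[f]_C$ are nonzero and a subset of $(g_j)_{j\in J}$ is linearly independent over $\mathbb C$ if and only if its reduction is linearly independent over $\mathbb F_p$. Let $V$ be the $\mathbb F_p$-vector space with basis $F(j_1,\dots,j_k)$ indexed by the subsets $\{j_1<\dots<j_k\}\subset J$ with $g_{j_1},\dots,g_{j_k}$ linearly independent. Extend the symbol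 $F(j_1,\dots,j_k)$ to all tuples by skew-symmetry and by $0$ for dependent tuples, and extend the coordinates $I_{j_1,\dots,j_k}$ of a vector $I=\sum I_{j_1,\dots,j_k}F(j_1,\dots,j_k)$ (sum over independent $j_1<\dots<j_k$) in the same way. Let $a_j$, $j\in J$, be nonzero integers and $\kappa$ an integer with $[\kappa]\ne0$. For $C=\{i_1<\dots<i_r\}\in\mathfrak C$ define the linear operator $[L]_C:V\to V$ by $[L]_CF(j_1,\dots,j_k)=0$ if $|\{j_1,\dots,j_k\}\cap C|<r-1$, and $$[L]_C F(i_1,\dots,\widehat{i_m},\dots,i_r,s_1,\dots,s_{k-r+1})=(-1)^m\sum_{l=1}^r(-1)^l[a_{i_l}]\,F(i_1,\dots,\widehat{i_l},\dots,i_r,s_1,\dots,s_{k-r+1})$$ for $s_1,\dots,s_{k-r+1}\notin C$. Put $[K]_i(z)=\sum_{C\in\mathfrak C}\dfrac{[\lambda_C^i]}{[f]_C(z)}[L]_C$ for $i\in J$. **Theorem.** Let $p$ be good with respect to $(g_j)_{j\in J}$. Let $A_1,\dots,A_n$ be positive integers with $[A_j]=[a_j]/[\kappa]$ in $\mathbb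 F_p$ for all $j$, let $q=(q_1,\dots,q_k)\in\mathbb Z^k$, and let $l_1,\dots,l_k$ be positive integers. For independent $\{j_1<\dots<j_k\}\subset J$ consider the polynomial $$X_{j_1,\dots,j_k}(z,t)=\prod_{j\in J}f_j(z,t)^{A_j}\cdot\frac{\det_{i,m=1}^k(b_{j_m}^i)}{\prod_{m=1}^kf_{j_m}(z,t)}\in\mathbb Z[z_1,\dots,z_n,t_1,\dots,t_k],$$ and let $[I]_{j_1,\dots,j_k}(z)\in\mathbb F_p[z_1,\dots,z_n]$ be the reduction modulo $p$ of the coefficient of $(t_1-q_1)^{l_1p-1}\cdots(t_k-q_k)^{l_kp-1}$ in its Taylor expansion at $t=q$. Then the polynomial vector $I(z)=\sum[I]_{j_1,\dots,j_k}(z)F(j_1,\dots,j_k)\in V\otimes\mathbb F_p[z_1,\dots,z_n]$ (sum over independent $j_1<\dots<j_k$) satisfies the singular-vector equations $$\sum_{j\in J}[a_j]\,I_{j,j_2,\dots,j_k}(z)=0\qquad\text{for all }j_2,\dots,j_k\in J,$$ and the Gauss–Manin differential equations $$[\kappa]\frac{\partial I}{\partial z_i}(z)=[K]_i(z)I(z),\qquad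 i\in J,$$ over $\mathbb F_p$, as identities of rational functions of $z$. -/

import Mathlib

namespace ParallelArr

/-! A collection of linear functions `g_j = b_j^1 t_1 + ... + b_j^k t_k`, `j ∈ J = Fin n`, with integer
coefficients is given by `b : Fin n → Fin k → ℤ`, `b j r` being the coefficient of `t_r` in `g_j`. -/

section Matroid

variable {n k : ℕ}

/-- The coefficient vector of `g_j`, mapped to a field `F`. -/
def gVec (F : Type*) [Field F] (b : Fin n → Fin k → ℤ) (j : Fin n) : Fin k → F :=
  fun r => (b j r : F)

/-- Independent sets of the matroid on `J` defined by the linear functions `g_j` over `F`. -/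
def IsIndep (F : Type*) [Field F] (b : Fin n → Fin k → ℤ) (S : Finset (Fin n)) : Prop :=
  LinearIndependent F (fun j : S => gVec F b j)

/-- Circuits: dependent sets, all of whose proper subsets are independent. -/
def IsCircuit (F : Type*) [Field F] (b : Fin n → Fin k → ℤ) (C : Finset (Fin n)) : Prop :=
  ¬ IsIndep F b C ∧ ∀ D : Finset (Fin n), D ⊂ C → IsIndep F b D

open Classical in
/-- The finite set of circuits over `ℂ`. -/
noncomputable def circuits (b : Fin n → Fin k → ℤ) : Finset (Finset (Fin n)) :=
  Finset.univ.filter (IsCircuit ℂ b)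

/-- `p` is good for `(g_j)`: all reduced functions `[g]_j` are nonzero, and the matroids over `ℂ` and
over `𝔽_p` coincide. (The reductions of `z_j + g_j` and of the primitive forms `f_C` never vanish.) -/
def IsGood (b : Fin n → Fin k → ℤ) (p : ℕ) [Fact p.Prime] : Prop :=
  (∀ j, gVec (ZMod p) b j ≠ 0) ∧
    ∀ S : Finset (Fin n), IsIndep ℂ b S ↔ IsIndep (ZMod p) b S

/-- `lam C i` are admissible coefficients `λ_C^i` of the circuit forms `f_C = ∑ λ_C^i z_i`: for every
circuit `C`, they are integers with greatest common divisor one, supported on `C`, and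
`∑_i λ_C^i g_i = 0`. They exist and are unique up to a sign for each `C`. -/
def IsCircuitCoeff (b : Fin n → Fin k → ℤ) (lam : Finset (Fin n) → Fin n → ℤ) : Prop :=
  ∀ C ∈ circuits b, (∀ i, i ∉ C → lam C i = 0) ∧
    (∀ r : Fin k, ∑ i, lam C i * b i r = 0) ∧ Finset.univ.gcd (lam C) = 1

/-- The index set `{j_1 < ... < j_k}` independent, of the standard basis `F(H_{j_1}, ..., H_{j_k})`. -/
def Bases (b : Fin n → Fin k → ℤ) : Type :=
  {T : Finset (Fin n) // T.card = k ∧ IsIndep ℂ b T}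

noncomputable instance (b : Fin n → Fin k → ℤ) : Fintype (Bases b) :=
  @Fintype.ofFinite _ (inferInstanceAs (Finite {T : Finset (Fin n) // T.card = k ∧ IsIndep ℂ b T}))

noncomputable instance (b : Fin n → Fin k → ℤ) : DecidableEq (Bases b) := Classical.decEq _

/-- The increasing enumeration `j_1 < ... < j_k` of a basis. -/
def Bases.enum {b : Fin n → Fin k → ℤ} (T : Bases b) : Fin k → Fin n :=
  T.1.orderEmbOfFin T.2.1

/-- The space `V ⊗ R`, in coordinates with respect to the standard basis. -/
abbrev Space (b : Fin n → Fin k → ℤ) (R : Type*) := Bases b → R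

/-- The coefficient of the standard basis vector indexed by `T` in `F(H_{i_1}, ..., H_{i_k})`, for an
arbitrary tuple `(i_1, ..., i_k)`: it is the sign of `σ` if `i_m = j_{σ(m)}` for the increasing
enumeration `j` of `T`, and `0` if there is no such `σ`. -/
def flagCoeff {b : Fin n → Fin k → ℤ} (s : List (Fin n)) (T : Bases b) : ℤ :=
  ∑ σ : Equiv.Perm (Fin k),
    if s = List.ofFn (fun m => T.enum (σ m)) then (Equiv.Perm.sign σ : ℤ) else 0

/-- The vector `F(H_{i_1}, ..., H_{i_k})` for an arbitrary tuple: skew-symmetric in the tuple,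
and zero when the hyperplanes are dependent. -/
def flagVec (b : Fin n → Fin k → ℤ) (R : Type*) [CommRing R] (s : List (Fin n)) : Space b R :=
  fun T => (flagCoeff s T : R)

/-- The coordinate `I_{i_1, ..., i_k}` of a vector of `V ⊗ R`, for an arbitrary tuple; skew-symmetric
in the tuple and zero when the hyperplanes are dependent. -/
noncomputable def coord {b : Fin n → Fin k → ℤ} {R : Type*} [CommRing R] (I : Space b R)
    (s : List (Fin n)) : R :=
  ∑ T, (flagCoeff s T : R) * I T

/-- Singular vectors: `∑_j a_j I_{j, j_2, ..., j_k} = 0` for all `j_2, ..., j_k ∈ J`. -/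
def IsSingular {b : Fin n → Fin k → ℤ} {R : Type*} [CommRing R] (a : Fin n → R)
    (I : Space b R) : Prop :=
  ∀ s : Fin (k - 1) → Fin n, ∑ j, a j * coord I (j :: List.ofFn s) = 0

/-- The zero-based position of `i` in the increasing enumeration of `C`. -/
def pos (C : Finset (Fin n)) (i : Fin n) : ℕ := (C.filter (· < i)).card

/-- For `C = {i_1 < ... < i_r}`, the tuple `(i_1, ..., î_l, ..., i_r, s_1, ..., s_{k-r+1})`, where
`i = i_l` and `S = {s_1 < s_2 < ...}`. -/
def swapTuple (C S : Finset (Fin n)) (i : Fin n) : List (Fin n) :=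
  (C.erase i).sort (· ≤ ·) ++ S.sort (· ≤ ·)

/-- The value of `L_C` on the standard basis vector `F_T`. It is zero unless
`T ∩ C = C - {i_m}` for some (unique) `m`; then `F_T = ε F(C - i_m, T - C)` with `ε = ±1` and
`L_C F_T = ε (-1)^m ∑_l (-1)^l a_{i_l} F(C - i_l, T - C)`. -/
def circuitOpBasis (b : Fin n → Fin k → ℤ) {R : Type*} [CommRing R] (a : Fin n → R)
    (C : Finset (Fin n)) (T : Bases b) : Space b R :=
  ∑ i ∈ C, if T.1 ∩ C = C.erase i then
      ((flagCoeff (swapTuple C (T.1 \ C) i) T : R) * (-1) ^ pos C i) •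
        ∑ l ∈ C, ((-1) ^ pos C l * a l) • flagVec b R (swapTuple C (T.1 \ C) l)
    else 0

/-- The linear operator `L_C`. -/
noncomputable def circuitOp (b : Fin n → Fin k → ℤ) {R : Type*} [CommRing R] (a : Fin n → R)
    (C : Finset (Fin n)) : Space b R →ₗ[R] Space b R :=
  (Pi.basisFun R (Bases b)).constr R (circuitOpBasis b a C)

end Matroid

section GaussManin

variable {n k : ℕ} (p : ℕ) [Fact p.Prime]

/-- The field `𝔽_p(z_1, ..., z_n)` of rational functions. -/
abbrev RatFun (n p : ℕ) [Fact p.Prime] := FractionRing (MvPolynomial (Fin n) (ZMod p))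

/-- The linear function `[f]_C = ∑_i [λ_C^i] z_i`. -/
noncomputable def circuitForm (lam : Finset (Fin n) → Fin n → ℤ) (C : Finset (Fin n)) :
    MvPolynomial (Fin n) (ZMod p) :=
  ∑ i, MvPolynomial.C (lam C i : ZMod p) * MvPolynomial.X i

/-- The geometric Hamiltonian `[K]_i(z) = ∑_C ([λ_C^i] / [f]_C(z)) [L]_C`, acting on `V ⊗ 𝔽_p(z)`. -/
noncomputable def hamiltonian (b : Fin n → Fin k → ℤ) (lam : Finset (Fin n) → Fin n → ℤ)
    (a : Fin n → ℤ) (i : Fin n) : Space b (RatFun n p) →ₗ[RatFun n p] Space b (RatFun n p) :=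
  ∑ C ∈ circuits b,
    ((lam C i : RatFun n p) / algebraMap _ (RatFun n p) (circuitForm p lam C)) •
      circuitOp b (fun j => (a j : RatFun n p)) C

/-- The Gauss-Manin equations `[κ] ∂I/∂z_i = [K]_i(z) I`, `i ∈ J`, for a polynomial vector `I(z)`, as
identities in `V ⊗ 𝔽_p(z)`. -/
def SatisfiesGaussManin (b : Fin n → Fin k → ℤ) (lam : Finset (Fin n) → Fin n → ℤ)
    (a : Fin n → ℤ) (κ : ℤ) (I : Space b (MvPolynomial (Fin n) (ZMod p))) : Prop :=
  ∀ i : Fin n,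
    (κ : RatFun n p) • (fun T => algebraMap _ (RatFun n p) (MvPolynomial.pderiv i (I T))) =
      hamiltonian p b lam a i (fun T => algebraMap _ (RatFun n p) (I T))

end GaussManin

section Solutions

variable {n k : ℕ}

/-- `ℤ[z_1, ..., z_n][t_1, ..., t_k]`. -/
abbrev PolyZT (n k : ℕ) := MvPolynomial (Fin k) (MvPolynomial (Fin n) ℤ)

/-- `f_j(z,t) = z_j + b_j^1 t_1 + ... + b_j^k t_k`. -/
noncomputable def affineForm (b : Fin n → Fin k → ℤ) (j : Fin n) : PolyZT n k :=
  MvPolynomial.C (MvPolynomial.X j) + ∑ r, (b j r : PolyZT n k) * MvPolynomial.X r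

/-- The master polynomial `Φ(z,t,A) = ∏_j f_j(z,t)^{A_j}`. -/
noncomputable def masterPoly (b : Fin n → Fin k → ℤ) (A : Fin n → ℕ) : PolyZT n k :=
  ∏ j, affineForm b j ^ A j

/-- `d_{j_1, ..., j_k} = det (b_{j_l}^i)`. -/
def minorDet (b : Fin n → Fin k → ℤ) (s : Fin k → Fin n) : ℤ :=
  Matrix.det (Matrix.of fun i l : Fin k => b (s l) i)

/-- The polynomial `X_{j_1, ..., j_k}(z,t,A) = Φ(z,t,A) d_{j_1, ..., j_k} / ∏_l f_{j_l}(z,t)`, for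
`{j_1 < ... < j_k}` independent and positive `A`; see `masterCoeff_mul_prod`. -/
noncomputable def masterCoeff (b : Fin n → Fin k → ℤ) (A : Fin n → ℕ) (T : Bases b) : PolyZT n k :=
  (minorDet b T.enum : PolyZT n k) * ∏ j, affineForm b j ^ (A j - if j ∈ T.1 then 1 else 0)

theorem masterCoeff_mul_prod (b : Fin n → Fin k → ℤ) (A : Fin n → ℕ) (hA : ∀ j, 0 < A j)
    (T : Bases b) :
    masterCoeff b A T * ∏ l : Fin k, affineForm b (T.enum l) =
      masterPoly b A * (minorDet b T.enum : PolyZT n k) := by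
  have h1 : ∏ l : Fin k, affineForm b (T.enum l) = ∏ j ∈ T.1, affineForm b j := by
    have h2 : T.1 = Finset.univ.map (T.1.orderEmbOfFin T.2.1).toEmbedding := by
      ext x
      simp only [Finset.mem_map, Finset.mem_univ, true_and]
      have := Set.ext_iff.1 (Finset.range_orderEmbOfFin T.1 T.2.1) x
      exact this.symm
    conv_rhs => rw [h2]
    rw [Finset.prod_map]
    rfl
  have h3 : ∏ j ∈ T.1, affineForm b j = ∏ j, affineForm b j ^ (if j ∈ T.1 then 1 else 0) := by
    rw [← Finset.prod_subset (Finset.subset_univ T.1)]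
    · exact Finset.prod_congr rfl fun j hj => by simp [hj]
    · intro j _ hj
      simp [hj]
  rw [h1, h3, masterCoeff, masterPoly, mul_assoc, ← Finset.prod_mul_distrib, mul_comm]
  congr 1
  refine Finset.prod_congr rfl fun j _ => ?_
  rw [← pow_add]
  congr 1
  have := hA j
  split_ifs <;> omega

/-- The coefficient of `(t_1 - q_1)^{i_1} ... (t_k - q_k)^{i_k}` in the Taylor expansion at `t = q`,
that is, the coefficient of `t_1^{i_1} ... t_k^{i_k}` in `P(z, t + q)`; see `taylor_expansion`. -/
noncomputable def taylorCoeff (q : Fin k → ℤ) (e : Fin k →₀ ℕ) (P : PolyZT n k) :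
    MvPolynomial (Fin n) ℤ :=
  MvPolynomial.coeff e
    (MvPolynomial.aeval (fun r => (MvPolynomial.X r + (q r : PolyZT n k) : PolyZT n k)) P)

theorem taylor_expansion (q : Fin k → ℤ) (P : PolyZT n k) :
    ∃ N : Finset (Fin k →₀ ℕ), (∀ e, e ∉ N → taylorCoeff q e P = 0) ∧
      P = ∑ e ∈ N, MvPolynomial.C (taylorCoeff q e P) *
        ∏ r, (MvPolynomial.X r - (q r : PolyZT n k)) ^ e r := by
  set Q : PolyZT n k :=
    MvPolynomial.aeval (fun r => (MvPolynomial.X r + (q r : PolyZT n k) : PolyZT n k)) P with hQ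
  refine ⟨Q.support, fun e he => ?_, ?_⟩
  · exact MvPolynomial.notMem_support_iff.1 he
  · have h : MvPolynomial.aeval
        (fun r => (MvPolynomial.X r - (q r : PolyZT n k) : PolyZT n k)) Q = P := by
      rw [hQ, ← AlgHom.comp_apply]
      have : (MvPolynomial.aeval
          (fun r => (MvPolynomial.X r - (q r : PolyZT n k) : PolyZT n k))).comp
          (MvPolynomial.aeval
            (fun r => (MvPolynomial.X r + (q r : PolyZT n k) : PolyZT n k))) =
          AlgHom.id (MvPolynomial (Fin n) ℤ) (PolyZT n k) := by
        apply MvPolynomial.algHom_ext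
        intro r
        simp
      rw [this]
      rfl
    conv_lhs => rw [← h, MvPolynomial.aeval_def, MvPolynomial.eval₂_eq']
    rfl

/-- `[I]^{i_1, ..., i_k}(z,q,A) ∈ V ⊗ 𝔽_p[z]`: the reduction modulo `p` of the vector of Taylor
coefficients of the polynomials `X_{j_1, ..., j_k}`. -/
noncomputable def solutionVec (p : ℕ) (b : Fin n → Fin k → ℤ) (A : Fin n → ℕ) (q : Fin k → ℤ)
    (e : Fin k →₀ ℕ) : Space b (MvPolynomial (Fin n) (ZMod p)) :=
  fun T => MvPolynomial.map (Int.castRingHom (ZMod p)) (taylorCoeff q e (masterCoeff b A T))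

end Solutions

end ParallelArr

/-! Everything reduces to the polynomials `P(E)` (`taylorProd`), the reductions mod `p` of the
Taylor coefficient at `t^e` of `∏ f_j(z, t + q) ^ E_j`. They satisfy three contiguity relations. (1)
`∂P(E)/∂z_i = E_i P(E - 1_i)`, since `∂f_j/∂z_i = δ_ij`. (2) `∑_l b_l^r E_l P(E - 1_l) = 0`
(`sum_mul_taylorProd_sub`). This is the analogue of Stokes' theorem: the coefficient of `t^e` in a
`t_r`-derivative carries the factor `e_r + 1`, a multiple of `p`. (3) If `∑ c_l g_l = 0`, then `∑
c_l P(E + 1_l) = (∑ c_l z_l) P(E)` (`sum_mul_taylorProd_add`), since `∑ c_l f_l` is free of `t`.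

The coordinate of the solution at a tuple with underlying set `S` is its minor times `P(A - 1_S)`.
Expanding the minor of `(j, j_2, ..., j_k)` along the column of `j` turns the singular-vector
equations into a combination of (2), because `a_j = κ A_j` mod `p`.

For the Gauss-Manin equations fix a basis `T`. Each `l ∉ T` has a unique fundamental circuit `D_l ⊆
T ∪ {l}`. Both sides of the `T`-coordinate are shown to equal `∑_{l ∉ T} (λ_{D_l}^i / λ_{D_l}^l) a_l
d_T P(A - 1_{T ∪ l})`. For the derivative (`kappa_mul_pderiv_solutionVec`) this follows from (1),
together with (2) contracted with the vector dual to `g_i` when `i ∈ T`. For the Hamiltonian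
(`hamiltonian_solutionVec`), `L_C` contributes only if `C` is some `D_l`. By Cramer's rule the
minors omitting one element of `C` are proportional, up to sign, to the `λ_C^i`, so (3) produces a
factor `f_C` that cancels the denominator (`circuitCoeff_mul_sum_coord`). -/

namespace ParallelArr

/-! ### Derivations acting on coefficients -/

section CoeffDerivation

variable {A R σ : Type*} [CommRing A] [CommRing R] [Algebra A R]

/-- The coefficientwise extension of a derivation of `R` to `R[σ]`. -/
noncomputable def coeffDerivation (σ : Type*) (d : Derivation A R R) :
    Derivation A (MvPolynomial σ R) (MvPolynomial σ R) :=
  have hc : ∀ (P : MvPolynomial σ R) (e : σ →₀ ℕ),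
      MvPolynomial.coeff e (.ofCoeff (Finsupp.mapRange d (map_zero d) (AddMonoidAlgebra.coeff P))) =
        d (MvPolynomial.coeff e P) := fun _ _ => rfl
  Derivation.mk'
    { toFun := fun P => .ofCoeff (Finsupp.mapRange d (map_zero d) (AddMonoidAlgebra.coeff P))
      map_add' := fun P Q => by
        ext e
        rw [MvPolynomial.coeff_add, hc, hc, hc, MvPolynomial.coeff_add, map_add]
      map_smul' := fun c P => by
        ext e
        simp only [RingHom.id_apply, MvPolynomial.coeff_smul, hc]
        exact d.map_smul c _ }
    (fun P Q => by
      classical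
      ext e
      simp only [LinearMap.coe_mk, AddHom.coe_mk, smul_eq_mul, MvPolynomial.coeff_add, hc,
        MvPolynomial.coeff_mul, map_sum, Derivation.leibniz, Finset.sum_add_distrib]
      congr 1
      -- The term `Q * d P` lists its factors in the opposite order, hence the swap of the
      -- antidiagonal.
      exact Finset.sum_equiv (Equiv.prodComm _ _) (fun x => by simp [add_comm]) fun x _ => rfl)

theorem coeff_coeffDerivation (d : Derivation A R R) (P : MvPolynomial σ R) (e : σ →₀ ℕ) :
    MvPolynomial.coeff e (coeffDerivation σ d P) = d (MvPolynomial.coeff e P) := rfl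

theorem coeffDerivation_C (d : Derivation A R R) (c : R) :
    coeffDerivation σ d (MvPolynomial.C c) = MvPolynomial.C (d c) := by
  classical
  ext e
  rw [coeff_coeffDerivation, MvPolynomial.coeff_C, MvPolynomial.coeff_C]
  split_ifs <;> simp

theorem coeffDerivation_X (d : Derivation A R R) (i : σ) :
    coeffDerivation σ d (MvPolynomial.X i) = 0 := by
  classical
  ext e
  rw [coeff_coeffDerivation, MvPolynomial.coeff_X]
  split_ifs <;> simp

/-- Truncated subtraction in `E - Pi.single l 1` is harmless: where it truncates, the factor `E l`
is zero. -/
theorem derivation_prod_pow {ι : Type*} [DecidableEq ι] (D : Derivation A R R) (f : ι → R)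
    (E : ι → ℕ) (s : Finset ι) :
    D (∏ j ∈ s, f j ^ E j) =
      ∑ l ∈ s, (E l : R) * (D (f l) * ∏ j ∈ s, f j ^ (E - Pi.single l 1 : ι → ℕ) j) := by
  induction s using Finset.induction_on with
  | empty => simp
  | insert i s hi ih =>
    rw [Finset.prod_insert hi, Derivation.leibniz, ih, Finset.sum_insert hi, Derivation.leibniz_pow,
      Finset.prod_insert hi]
    have h1 : ∏ j ∈ s, f j ^ (E - Pi.single i 1 : ι → ℕ) j = ∏ j ∈ s, f j ^ E j := by
      refine Finset.prod_congr rfl fun j hj => ?_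
      have : j ≠ i := fun h => hi (h ▸ hj)
      simp [this]
    rw [h1, smul_eq_mul, smul_eq_mul, Finset.mul_sum, add_comm]
    congr 1
    · simp only [nsmul_eq_mul, smul_eq_mul, Pi.sub_apply, Pi.single_eq_same]
      ring
    · refine Finset.sum_congr rfl fun l hl => ?_
      have : i ≠ l := fun h => hi (h ▸ hl)
      rw [Finset.prod_insert hi]
      simp only [Pi.sub_apply, Pi.single_eq_of_ne this, Nat.sub_zero]
      ring

end CoeffDerivation

/-! ### Contiguity relations for Taylor coefficients mod `p` -/

section TaylorProduct

variable {n k : ℕ} (p : ℕ) (b : Fin n → Fin k → ℤ) (q : Fin k → ℤ) (e : Fin k →₀ ℕ)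

/-- The reduction modulo `p` of `f_j(z, t + q)`. -/
noncomputable def shiftedForm (j : Fin n) : MvPolynomial (Fin k) (MvPolynomial (Fin n) (ZMod p)) :=
  MvPolynomial.C (MvPolynomial.X j + ∑ r, ((b j r * q r : ℤ) : MvPolynomial (Fin n) (ZMod p))) +
    ∑ r, (b j r : MvPolynomial (Fin k) (MvPolynomial (Fin n) (ZMod p))) * MvPolynomial.X r

/-- The reduction modulo `p` of the Taylor coefficient with exponent `e` of `∏_j f_j ^ (E j)`. -/
noncomputable def taylorProd (E : Fin n → ℕ) : MvPolynomial (Fin n) (ZMod p) :=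
  MvPolynomial.coeff e (∏ j, shiftedForm p b q j ^ E j)

theorem solutionVec_eq (A : Fin n → ℕ) (T : Bases b) :
    solutionVec p b A q e T = (minorDet b T.enum : MvPolynomial (Fin n) (ZMod p)) *
      taylorProd p b q e (fun j => A j - if j ∈ T.1 then 1 else 0) := by
  have h : ∀ j, MvPolynomial.map (MvPolynomial.map (Int.castRingHom (ZMod p)))
      (MvPolynomial.aeval (fun r => (MvPolynomial.X r + (q r : PolyZT n k) : PolyZT n k))
        (affineForm b j)) = shiftedForm p b q j := by
    intro j
    simp only [affineForm, shiftedForm, map_add, map_sum, map_mul, MvPolynomial.aeval_X,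
      map_intCast, MvPolynomial.map_X, mul_add, Finset.sum_add_distrib, Int.cast_mul]
    rw [← MvPolynomial.algebraMap_eq, AlgHom.commutes, MvPolynomial.algebraMap_eq,
      MvPolynomial.map_C, MvPolynomial.map_X]
    ring
  rw [solutionVec, taylorCoeff, ← MvPolynomial.coeff_map, masterCoeff, taylorProd]
  simp only [map_mul, map_prod, map_pow, h, map_intCast]
  rw [← map_intCast (MvPolynomial.C (σ := Fin k) (R := MvPolynomial (Fin n) (ZMod p))),
    MvPolynomial.coeff_C_mul]

/-- Differentiation in `z` acts on the coefficients of a polynomial in `t`, so it commutes with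
extracting the coefficient of `t^e`. -/
theorem pderiv_taylorProd (i : Fin n) (E : Fin n → ℕ) :
    MvPolynomial.pderiv i (taylorProd p b q e E) =
      (E i : MvPolynomial (Fin n) (ZMod p)) * taylorProd p b q e (E - Pi.single i 1) := by
  have h : ∀ j, coeffDerivation (Fin k) (MvPolynomial.pderiv i) (shiftedForm p b q j) =
      if j = i then 1 else 0 := by
    intro j
    simp only [shiftedForm, map_add, coeffDerivation_C, map_sum, Derivation.leibniz,
      coeffDerivation_X, Derivation.map_intCast, MvPolynomial.pderiv_X]
    simp [Pi.single_apply, eq_comm]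
  rw [taylorProd, ← coeff_coeffDerivation, derivation_prod_pow]
  simp only [h, ite_mul, one_mul, zero_mul, mul_ite, mul_zero, Finset.sum_ite_eq',
    Finset.mem_univ, if_true]
  rw [← map_natCast (MvPolynomial.C (σ := Fin k) (R := MvPolynomial (Fin n) (ZMod p))),
    MvPolynomial.coeff_C_mul, taylorProd]

/-- Stokes mod `p`: the coefficient of `t^e` in `∂/∂t_r` of the product has the factor `e r + 1`,
which vanishes in `𝔽_p`. -/
theorem sum_mul_taylorProd_sub [Fact p.Prime] (r : Fin k) (he : ((e r + 1 : ℕ) : ZMod p) = 0)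
    (E : Fin n → ℕ) :
    ∑ l, (b l r : MvPolynomial (Fin n) (ZMod p)) * (E l * taylorProd p b q e (E - Pi.single l 1)) =
      0 := by
  have h : ∀ j, MvPolynomial.pderiv r (shiftedForm p b q j) =
      MvPolynomial.C (b j r : MvPolynomial (Fin n) (ZMod p)) := by
    intro j
    simp only [shiftedForm, map_add, MvPolynomial.pderiv_C, map_sum, Derivation.leibniz,
      Derivation.map_intCast, MvPolynomial.pderiv_X]
    simp [Pi.single_apply]
  have h0 : MvPolynomial.coeff e (MvPolynomial.pderiv r (∏ j, shiftedForm p b q j ^ E j)) = 0 := by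
    rw [MvPolynomial.coeff_pderiv]
    have : ((e r : MvPolynomial (Fin n) (ZMod p)) + 1) = 0 := by
      rw [← Nat.cast_one, ← Nat.cast_add, ← map_natCast (MvPolynomial.C (σ := Fin n)), he, map_zero]
    rw [this, mul_zero]
  have h1 : MvPolynomial.pderiv r (∏ j, shiftedForm p b q j ^ E j) =
      ∑ l, (E l : MvPolynomial (Fin k) (MvPolynomial (Fin n) (ZMod p))) *
        (MvPolynomial.pderiv r (shiftedForm p b q l) *
          ∏ j, shiftedForm p b q j ^ (E - Pi.single l 1 : Fin n → ℕ) j) :=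
    derivation_prod_pow (MvPolynomial.pderiv r) _ E Finset.univ
  rw [h1, MvPolynomial.coeff_sum] at h0
  rw [← h0]
  refine Finset.sum_congr rfl fun l _ => ?_
  rw [h, ← map_natCast (MvPolynomial.C (σ := Fin k) (R := MvPolynomial (Fin n) (ZMod p))),
    MvPolynomial.coeff_C_mul, MvPolynomial.coeff_C_mul, taylorProd]
  ring

/-- The combination `∑ c_l f_l` loses its `t`-part and its shift by `q`, so it is a scalar in `z`
and can be pulled out of the coefficient. -/
theorem sum_mul_taylorProd_add (c : Fin n → ℤ) (hc : ∀ r, ∑ j, c j * b j r = 0) (E : Fin n → ℕ) :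
    ∑ l, (c l : MvPolynomial (Fin n) (ZMod p)) * taylorProd p b q e (E + Pi.single l 1) =
      (∑ l, (c l : MvPolynomial (Fin n) (ZMod p)) * MvPolynomial.X l) * taylorProd p b q e E := by
  have h1 : ∑ l, (c l : MvPolynomial (Fin k) (MvPolynomial (Fin n) (ZMod p))) *
      shiftedForm p b q l =
      MvPolynomial.C (∑ l, (c l : MvPolynomial (Fin n) (ZMod p)) * MvPolynomial.X l) := by
    have h2 : ∀ r, ∑ l, (c l : MvPolynomial (Fin k) (MvPolynomial (Fin n) (ZMod p))) * b l r = 0 :=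
      fun r => by
        have := congrArg
          (Int.cast (R := MvPolynomial (Fin k) (MvPolynomial (Fin n) (ZMod p)))) (hc r)
        simpa only [Int.cast_sum, Int.cast_mul, Int.cast_zero] using this
    simp only [shiftedForm, mul_add, Finset.sum_add_distrib, map_add, map_sum, map_mul,
      map_intCast, Int.cast_mul, Finset.mul_sum]
    rw [Finset.sum_comm (f := fun l r => _ * (_ * (_ : MvPolynomial _ _))), Finset.sum_comm
      (f := fun l r => _ * (_ * MvPolynomial.X _))]
    simp only [← mul_assoc, ← Finset.sum_mul, h2]
    simp
  rw [taylorProd, ← MvPolynomial.coeff_C_mul, ← h1, Finset.sum_mul, MvPolynomial.coeff_sum]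
  refine Finset.sum_congr rfl fun l _ => ?_
  rw [taylorProd, ← MvPolynomial.coeff_C_mul, map_intCast, mul_assoc]
  congr 2
  rw [← Finset.mul_prod_erase _ _ (Finset.mem_univ l),
    ← Finset.mul_prod_erase (a := l) Finset.univ _ (Finset.mem_univ l)]
  simp only [Pi.add_apply, Pi.single_eq_same, pow_succ']
  rw [mul_assoc]
  congr 2
  refine Finset.prod_congr rfl fun j hj => ?_
  rw [Pi.single_eq_of_ne (Finset.ne_of_mem_erase hj), add_zero]

end TaylorProduct

/-! ### Tuples, signs and minors -/

section Tuples

variable {n k : ℕ} {b : Fin n → Fin k → ℤ}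

theorem Bases.enum_injective (T : Bases b) : Function.Injective T.enum :=
  (T.1.orderEmbOfFin T.2.1).injective

theorem Bases.range_enum (T : Bases b) : Set.range T.enum = T.1 :=
  Finset.range_orderEmbOfFin T.1 T.2.1

theorem flagCoeff_enum_comp (T : Bases b) (σ : Equiv.Perm (Fin k)) :
    flagCoeff (List.ofFn fun m => T.enum (σ m)) T = Equiv.Perm.sign σ := by
  rw [flagCoeff, Finset.sum_eq_single σ]
  · simp
  · intro τ _ hτ
    rw [if_neg]
    intro h
    apply hτ
    ext m
    have := congrFun (List.ofFn_injective h) m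
    rw [T.enum_injective this]
  · simp

theorem exists_perm_of_flagCoeff_ne_zero {s : List (Fin n)} {T : Bases b} (h : flagCoeff s T ≠ 0) :
    ∃ σ : Equiv.Perm (Fin k), s = List.ofFn fun m => T.enum (σ m) := by
  obtain ⟨σ, _, hσ⟩ := Finset.exists_ne_zero_of_sum_ne_zero h
  refine ⟨σ, ?_⟩
  by_contra h'
  exact hσ (if_neg h')

theorem mem_iff_of_flagCoeff_ne_zero {s : List (Fin n)} {T : Bases b} (h : flagCoeff s T ≠ 0)
    (j : Fin n) : j ∈ s ↔ j ∈ T.1 := by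
  obtain ⟨σ, rfl⟩ := exists_perm_of_flagCoeff_ne_zero h
  rw [← Finset.mem_coe, ← T.range_enum, List.mem_ofFn]
  exact Set.ext_iff.1 (σ.surjective.range_comp T.enum) j

theorem minorDet_enum_comp (T : Bases b) (σ : Equiv.Perm (Fin k)) :
    minorDet b (fun m => T.enum (σ m)) = Equiv.Perm.sign σ * minorDet b T.enum := by
  have := Matrix.det_permute' σ (Matrix.of fun i l : Fin k => b (T.enum l) i)
  simpa [minorDet, Matrix.submatrix] using this

theorem linearIndependent_of_minorDet_ne_zero {s : Fin k → Fin n} (h : minorDet b s ≠ 0) :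
    LinearIndependent ℂ (gVec ℂ b ∘ s) := by
  have h1 : (Matrix.of fun l i : Fin k => (b (s l) i : ℂ)).det ≠ 0 := by
    have : (Matrix.of fun l i : Fin k => (b (s l) i : ℂ)).det = (minorDet b s : ℂ) := by
      rw [← Matrix.det_transpose, minorDet, Int.cast_det]
      rfl
    rw [this]
    exact_mod_cast h
  exact Matrix.linearIndependent_rows_of_det_ne_zero h1

theorem exists_basis_of_minorDet_ne_zero {s : Fin k → Fin n} (h : minorDet b s ≠ 0) :
    ∃ (T : Bases b) (σ : Equiv.Perm (Fin k)), s = fun m => T.enum (σ m) := by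
  have hli := linearIndependent_of_minorDet_ne_zero h
  have hinj : Function.Injective s := hli.injective.of_comp
  have hcard : (Finset.univ.image s).card = k := by
    rw [Finset.card_image_of_injective _ hinj, Finset.card_univ, Fintype.card_fin]
  have hind : IsIndep ℂ b (Finset.univ.image s) := by
    have : LinearIndepOn ℂ (gVec ℂ b) (Finset.univ.image s : Finset (Fin n)) := by
      rw [Finset.coe_image, Finset.coe_univ, Set.image_univ, linearIndepOn_range_iff hinj]
      exact hli
    exact this
  let T : Bases b := ⟨Finset.univ.image s, hcard, hind⟩
  have hmem : ∀ m, ∃ x, T.enum x = s m := fun m => by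
    have : s m ∈ Set.range T.enum := by
      rw [T.range_enum]
      simp [T]
    exact this
  choose σ hσ using hmem
  have hσi : Function.Injective σ := fun x y hxy => hinj (by rw [← hσ, ← hσ, hxy])
  exact ⟨T, Equiv.ofBijective σ (Finite.injective_iff_bijective.1 hσi), funext fun m => (hσ m).symm⟩

/-- The exponents of `Φ / ∏_{j ∈ S} f_j`, when `A` is positive on `S`. -/
def lowerExp (A : Fin n → ℕ) (S : Finset (Fin n)) : Fin n → ℕ :=
  fun j => A j - if j ∈ S then 1 else 0

/-- Signs of reordering agree on both sides, and a tuple that does not enumerate a basis has zero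
minor. -/
theorem coord_solutionVec (p : ℕ) (A : Fin n → ℕ) (q : Fin k → ℤ) (e : Fin k →₀ ℕ)
    (s : Fin k → Fin n) :
    coord (solutionVec p b A q e) (List.ofFn s) = (minorDet b s : MvPolynomial (Fin n) (ZMod p)) *
      taylorProd p b q e (lowerExp A (Finset.univ.image s)) := by
  by_cases h : ∃ (T : Bases b) (σ : Equiv.Perm (Fin k)), s = fun m => T.enum (σ m)
  · obtain ⟨T, σ, rfl⟩ := h
    have hT : Finset.univ.image (fun m => T.enum (σ m)) = T.1 := by
      rw [← Finset.coe_inj, ← T.range_enum, Finset.coe_image, Finset.coe_univ, Set.image_univ]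
      exact σ.surjective.range_comp T.enum
    rw [coord, Finset.sum_eq_single T]
    · rw [flagCoeff_enum_comp, minorDet_enum_comp, hT, solutionVec_eq, Int.cast_mul, mul_assoc]
      rfl
    · intro T' _ hne
      have : flagCoeff (List.ofFn fun m => T.enum (σ m)) T' = 0 := by
        by_contra h0
        apply hne
        apply Subtype.ext
        ext j
        rw [← mem_iff_of_flagCoeff_ne_zero h0, ← hT]
        simp
      rw [this, Int.cast_zero, zero_mul]
    · simp
  · have h1 : minorDet b s = 0 := by
      by_contra h0
      exact h (exists_basis_of_minorDet_ne_zero h0)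
    rw [h1, Int.cast_zero, zero_mul]
    refine Finset.sum_eq_zero fun T _ => ?_
    have : flagCoeff (List.ofFn s) T = 0 := by
      by_contra h0
      obtain ⟨σ, hσ⟩ := exists_perm_of_flagCoeff_ne_zero h0
      exact h ⟨T, σ, List.ofFn_injective hσ⟩
    rw [this, Int.cast_zero, zero_mul]

theorem flagCoeff_mul_minorDet {T : Bases b} {s : Fin k → Fin n}
    (h : flagCoeff (List.ofFn s) T ≠ 0) :
    flagCoeff (List.ofFn s) T * minorDet b s = minorDet b T.enum := by
  obtain ⟨σ, hσ⟩ := exists_perm_of_flagCoeff_ne_zero h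
  obtain rfl := List.ofFn_injective hσ
  rw [flagCoeff_enum_comp, minorDet_enum_comp, ← mul_assoc, ← Units.val_mul, Int.units_mul_self]
  simp

theorem flagCoeff_ne_zero {T : Bases b} {s : Fin k → Fin n} (hs : Function.Injective s)
    (hT : Finset.univ.image s = T.1) : flagCoeff (List.ofFn s) T ≠ 0 := by
  have hmem : ∀ m, ∃ x, T.enum x = s m := fun m => by
    have : s m ∈ Set.range T.enum := by
      rw [T.range_enum, ← hT]
      simp
    exact this
  choose σ hσ using hmem
  have hσi : Function.Injective σ := fun x y hxy => hs (by rw [← hσ, ← hσ, hxy])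
  have : s = fun m => T.enum (Equiv.ofBijective σ (Finite.injective_iff_bijective.1 hσi) m) :=
    funext fun m => (hσ m).symm
  rw [this, flagCoeff_enum_comp]
  exact Units.ne_zero _

/-- The maximal minors of a `(k+1) × k` matrix are proportional to the coefficients of any linear
relation between its rows. -/
theorem mul_minorDet_succAbove (u : Fin (k + 1) → Fin n) (μ : Fin (k + 1) → ℤ)
    (hμ : ∀ r, ∑ m, μ m * b (u m) r = 0) (x y : Fin (k + 1)) :
    μ x * ((-1) ^ (y : ℕ) * minorDet b (fun m => u (y.succAbove m))) =
      μ y * ((-1) ^ (x : ℕ) * minorDet b (fun m => u (x.succAbove m))) := by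
  by_cases h0 : μ = 0
  · simp [h0]
  -- `w` is orthogonal to `μ`, so the square matrix with `w` as extra first column is still killed
  -- by `μ`. Expanding its determinant along `w` leaves just the two minors to be compared.
  let w : Fin (k + 1) → ℤ := Pi.single y (μ x) - Pi.single x (μ y)
  let M : Matrix (Fin (k + 1)) (Fin (k + 1)) ℤ :=
    Matrix.of fun i => (Fin.cons (w i) (b (u i)) : Fin (k + 1) → ℤ)
  have hM : M.det = 0 := by
    rw [← Matrix.exists_vecMul_eq_zero_iff]
    refine ⟨μ, h0, ?_⟩
    ext r
    refine Fin.cases ?_ (fun r => ?_) r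
    · simp [M, w, Matrix.vecMul, dotProduct, mul_sub, Pi.single_apply, mul_comm]
    · simpa [M, Matrix.vecMul, dotProduct] using hμ r
  rw [Matrix.det_succ_column_zero] at hM
  have hsub : ∀ i : Fin (k + 1), (M.submatrix i.succAbove Fin.succ).det =
      minorDet b (fun m => u (i.succAbove m)) := by
    intro i
    rw [← Matrix.det_transpose, minorDet]
    congr 1
  simp only [hsub] at hM
  simp only [M, w, Matrix.of_apply, Fin.cons_zero, Pi.sub_apply, Pi.single_apply, mul_sub, sub_mul,
    Finset.sum_sub_distrib, mul_ite, mul_zero, ite_mul, zero_mul, Finset.sum_ite_eq',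
    Finset.mem_univ, if_true] at hM
  linarith

theorem sort_erase_eq_eraseIdx (C : Finset (Fin n)) {i : Fin n} (hi : i ∈ C) :
    ∃ h : pos C i < (C.sort (· ≤ ·)).length, (C.sort (· ≤ ·))[pos C i] = i ∧
      (C.erase i).sort (· ≤ ·) = (C.sort (· ≤ ·)).eraseIdx (pos C i) := by
  have hr : i ∈ Set.range (C.orderEmbOfFin rfl) := by
    rw [Finset.range_orderEmbOfFin]
    exact hi
  obtain ⟨m, hm⟩ := hr
  have hpos : pos C i = m := by
    have : C.filter (· < i) = (Finset.Iio m).map (C.orderEmbOfFin rfl).toEmbedding := by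
      ext j
      simp only [Finset.mem_filter, Finset.mem_map, Finset.mem_Iio]
      constructor
      · rintro ⟨hj, hji⟩
        have hr : j ∈ Set.range (C.orderEmbOfFin rfl) := by
          rw [Finset.range_orderEmbOfFin]
          exact hj
        obtain ⟨x, rfl⟩ := hr
        exact ⟨x, by simpa [← hm] using hji, rfl⟩
      · rintro ⟨x, hx, rfl⟩
        exact ⟨Finset.orderEmbOfFin_mem C rfl x, by simpa [← hm] using hx⟩
    rw [pos, this, Finset.card_map, Fin.card_Iio]
  have hlen : pos C i < (C.sort (· ≤ ·)).length := by
    rw [hpos, Finset.length_sort]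
    exact m.2
  have hget : (C.sort (· ≤ ·))[pos C i] = i := by
    rw [Finset.orderEmbOfFin_apply] at hm
    simp only [hpos]
    exact hm
  refine ⟨hlen, hget, ?_⟩
  have hidx : (C.sort (· ≤ ·)).idxOf i = pos C i := by
    conv_lhs => rw [← hget]
    exact (Finset.sort_nodup C _).idxOf_getElem _ _
  rw [← hidx, List.eraseIdx_idxOf_eq_erase]
  refine List.Perm.eq_of_pairwise' (r := (· ≤ ·)) (Finset.pairwise_sort _ _)
    ((Finset.pairwise_sort C (· ≤ ·)).sublist List.erase_sublist) ?_
  rw [← Multiset.coe_eq_coe, Finset.sort_eq, ← Multiset.coe_erase, Finset.sort_eq,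
    Finset.erase_val]

/-- All tuples in `L_C` come from one `(k+1)`-tuple by omitting an entry. As `C` is listed before
`S`, the omitted position is `pos C i`, so the signs of `L_C` are those of `mul_minorDet_succAbove`.
-/
theorem exists_swapTuple_eq (C S : Finset (Fin n)) (hCS : Disjoint C S)
    (hcard : C.card + S.card = k + 1) :
    ∃ u : Fin (k + 1) → Fin n, Function.Injective u ∧ (∀ j, j ∈ Set.range u ↔ j ∈ C ∪ S) ∧
      ∀ i ∈ C, ∃ m : Fin (k + 1), (m : ℕ) = pos C i ∧ u m = i ∧
        swapTuple C S i = List.ofFn fun x => u (m.succAbove x) := by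
  have hlen : (C.sort (· ≤ ·) ++ S.sort (· ≤ ·)).length = k + 1 := by
    simpa using hcard
  have hnd : (C.sort (· ≤ ·) ++ S.sort (· ≤ ·)).Nodup := by
    refine List.Nodup.append (Finset.sort_nodup _ _) (Finset.sort_nodup _ _) fun x hx hy => ?_
    rw [Finset.mem_sort] at hx hy
    exact Finset.disjoint_left.1 hCS hx hy
  refine ⟨fun m => (C.sort (· ≤ ·) ++ S.sort (· ≤ ·))[(m : ℕ)]'(by omega), ?_, ?_, ?_⟩
  · intro x y hxy
    exact Fin.ext ((hnd.getElem_inj_iff).1 hxy)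
  · intro j
    have : j ∈ C ∪ S ↔ j ∈ C.sort (· ≤ ·) ++ S.sort (· ≤ ·) := by simp
    rw [this, List.mem_iff_getElem]
    constructor
    · rintro ⟨m, hm⟩
      exact ⟨m, by omega, hm⟩
    · rintro ⟨m, h, hm⟩
      exact ⟨⟨m, by omega⟩, hm⟩
  · intro i hi
    obtain ⟨hlt, hget, her⟩ := sort_erase_eq_eraseIdx C hi
    have hlt' : pos C i < k + 1 := by
      rw [Finset.length_sort] at hlt
      omega
    refine ⟨⟨pos C i, hlt'⟩, rfl, ?_, ?_⟩
    · simp only [List.getElem_append_left hlt, hget]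
    · rw [swapTuple, her, ← List.eraseIdx_append_of_lt_length hlt]
      refine List.ext_getElem ?_ fun x h1 h2 => ?_
      · rw [List.length_ofFn, List.length_eraseIdx_of_lt (by omega)]
        omega
      · rw [List.getElem_eraseIdx, List.getElem_ofFn]
        split_ifs with hx
        · simp [Fin.succAbove, Fin.lt_def, hx]
        · simp [Fin.succAbove, Fin.lt_def, hx]

end Tuples

/-! ### Fundamental circuits and good reduction -/

section Circuits

variable {n k : ℕ} {b : Fin n → Fin k → ℤ}

theorem isIndep_iff (F : Type*) [Field F] (b : Fin n → Fin k → ℤ) (S : Finset (Fin n)) :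
    IsIndep F b S ↔ ∀ c : Fin n → F, (∀ j, j ∉ S → c j = 0) →
      (∀ r, ∑ j, c j * (b j r : F) = 0) → c = 0 := by
  have h : IsIndep F b S ↔ LinearIndepOn F (gVec F b) (S : Set (Fin n)) := Iff.rfl
  rw [h, linearIndepOn_finset_iff]
  constructor
  · intro H c hS hc
    have h1 : ∑ j ∈ S, c j • gVec F b j = 0 := by
      rw [Finset.sum_subset (Finset.subset_univ S) fun j _ hj => by rw [hS j hj, zero_smul]]
      ext r
      simpa [gVec] using hc r
    ext j
    by_cases hj : j ∈ S
    · exact H c h1 j hj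
    · exact hS j hj
  · intro H c hc j hj
    have h1 := H (fun j => if j ∈ S then c j else 0) (fun j hj => if_neg hj) (fun r => by
      have := congrFun hc r
      simpa [gVec, ite_mul, Finset.sum_ite_mem] using this)
    simpa [hj] using congrFun h1 j

theorem IsIndep.mono {F : Type*} [Field F] {S D : Finset (Fin n)} (h : IsIndep F b S)
    (hD : D ⊆ S) : IsIndep F b D :=
  LinearIndepOn.mono (v := gVec F b) (s := (S : Set (Fin n))) h (Finset.coe_subset.2 hD)

theorem exists_circuit_subset {F : Type*} [Field F] (S : Finset (Fin n)) (h : ¬ IsIndep F b S) :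
    ∃ C ⊆ S, IsCircuit F b C := by
  induction S using Finset.strongInduction with
  | H S ih =>
    by_cases hS : ∀ D : Finset (Fin n), D ⊂ S → IsIndep F b D
    · exact ⟨S, subset_rfl, h, hS⟩
    · push Not at hS
      obtain ⟨D, hD, hDi⟩ := hS
      obtain ⟨C, hC, hCc⟩ := ih D hD hDi
      exact ⟨C, hC.trans hD.subset, hCc⟩

theorem mem_circuits {C : Finset (Fin n)} : C ∈ circuits b ↔ IsCircuit ℂ b C := by
  simp [circuits]

/-- `T ∪ {l}` consists of `k + 1` vectors in a `k`-dimensional space, and a circuit inside it must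
contain `l` because `T` is independent. -/
theorem exists_fundamental_circuit (T : Bases b) {l : Fin n} (hl : l ∉ T.1) :
    ∃ C ∈ circuits b, l ∈ C ∧ T.1 ∩ C = C.erase l := by
  have hdep : ¬ IsIndep ℂ b (insert l T.1) := by
    intro h
    have := LinearIndependent.fintype_card_le_finrank (R := ℂ) h
    rw [Fintype.card_coe, Finset.card_insert_of_notMem hl, T.2.1, Module.finrank_fin_fun] at this
    omega
  obtain ⟨C, hC, hCc⟩ := exists_circuit_subset _ hdep
  have hlC : l ∈ C := by
    by_contra h
    exact hCc.1 (T.2.2.mono ((Finset.subset_insert_iff_of_notMem h).1 hC))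
  refine ⟨C, mem_circuits.2 hCc, hlC, ?_⟩
  ext j
  have := @hC j
  grind

variable {p : ℕ} [Fact p.Prime] {lam : Finset (Fin n) → Fin n → ℤ}

theorem sum_circuitCoeff_cast (hlam : IsCircuitCoeff b lam) {C : Finset (Fin n)}
    (hC : C ∈ circuits b) (r : Fin k) :
    ∑ j, (lam C j : ZMod p) * (b j r : ZMod p) = 0 := by
  have := congrArg (Int.cast (R := ZMod p)) ((hlam C hC).2.1 r)
  simpa using this

/-- If `λ_C^i` vanished mod `p`, the relation would be supported on `C - i`, which stays independent
mod `p`. Then `p` would divide every `λ_C^j`, against gcd one. -/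
theorem circuitCoeff_cast_ne_zero_iff (hlam : IsCircuitCoeff b lam) (hp : IsGood b p)
    {C : Finset (Fin n)} (hC : C ∈ circuits b) (i : Fin n) :
    (lam C i : ZMod p) ≠ 0 ↔ i ∈ C := by
  constructor
  · intro h
    by_contra hi
    exact h (by rw [(hlam C hC).1 i hi, Int.cast_zero])
  · intro hi h0
    have hind : IsIndep (ZMod p) b (C.erase i) :=
      (hp.2 _).1 ((mem_circuits.1 hC).2 _ (Finset.erase_ssubset hi))
    have hz := (isIndep_iff _ _ _).1 hind (fun j => (lam C j : ZMod p)) (fun j hj => by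
      by_cases hji : j = i
      · rw [hji, h0]
      · have : j ∉ C := fun hjC => hj (Finset.mem_erase.2 ⟨hji, hjC⟩)
        rw [(hlam C hC).1 j this, Int.cast_zero]) (sum_circuitCoeff_cast hlam hC)
    have hdvd : (p : ℤ) ∣ Finset.univ.gcd (lam C) :=
      Finset.dvd_gcd fun j _ => (ZMod.intCast_zmod_eq_zero_iff_dvd _ p).1 (congrFun hz j)
    rw [(hlam C hC).2.2] at hdvd
    exact (Nat.Prime.ne_one Fact.out) (Int.natCast_dvd_natCast.1 (by exact_mod_cast hdvd) |>
      Nat.dvd_one.1)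

/-- Eliminating `l` between the two circuit relations leaves a relation supported on `T`, hence
trivial. So the relations are proportional mod `p` and have the same support. -/
theorem fundamental_circuit_unique (hlam : IsCircuitCoeff b lam) (hp : IsGood b p) (T : Bases b)
    {l : Fin n} {C D : Finset (Fin n)} (hC : C ∈ circuits b) (hlC : l ∈ C)
    (hTC : T.1 ∩ C = C.erase l) (hD : D ∈ circuits b) (hlD : l ∈ D)
    (hTD : T.1 ∩ D = D.erase l) : C = D := by
  have hT : IsIndep (ZMod p) b T.1 := (hp.2 _).1 T.2.2
  have key := (isIndep_iff _ _ _).1 hT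
    (fun j => (lam D l : ZMod p) * (lam C j : ZMod p) - (lam C l : ZMod p) * (lam D j : ZMod p))
    (fun j hj => by
      by_cases hjl : j = l
      · rw [hjl]
        ring
      · have h1 : j ∉ C := fun h => hj (Finset.mem_inter.1 (hTC ▸ Finset.mem_erase.2 ⟨hjl, h⟩)).1
        have h2 : j ∉ D := fun h => hj (Finset.mem_inter.1 (hTD ▸ Finset.mem_erase.2 ⟨hjl, h⟩)).1
        rw [(hlam C hC).1 j h1, (hlam D hD).1 j h2]
        simp)
    (fun r => by
      simp only [sub_mul, mul_assoc, Finset.sum_sub_distrib, ← Finset.mul_sum,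
        sum_circuitCoeff_cast hlam hC, sum_circuitCoeff_cast hlam hD, mul_zero, sub_zero])
  have hCl := (circuitCoeff_cast_ne_zero_iff hlam hp hC l).2 hlC
  have hDl := (circuitCoeff_cast_ne_zero_iff hlam hp hD l).2 hlD
  ext j
  rw [← circuitCoeff_cast_ne_zero_iff hlam hp hC j, ← circuitCoeff_cast_ne_zero_iff hlam hp hD j]
  have hj : (lam D l : ZMod p) * (lam C j : ZMod p) = (lam C l : ZMod p) * (lam D j : ZMod p) :=
    sub_eq_zero.1 (congrFun key j)
  constructor
  · intro h h'
    rw [h', mul_zero] at hj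
    exact mul_ne_zero hDl h hj
  · intro h h'
    rw [h', mul_zero] at hj
    exact mul_ne_zero hCl h hj.symm

theorem circuitForm_ne_zero (hlam : IsCircuitCoeff b lam) (hp : IsGood b p) {C : Finset (Fin n)}
    (hC : C ∈ circuits b) {i : Fin n} (hi : i ∈ C) : circuitForm p lam C ≠ 0 := by
  intro h
  have h1 : MvPolynomial.pderiv i (circuitForm p lam C) = MvPolynomial.C (lam C i : ZMod p) := by
    simp only [circuitForm, map_sum, MvPolynomial.pderiv_C_mul, MvPolynomial.pderiv_X]
    simp [Pi.single_apply]
  rw [h, map_zero] at h1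
  exact (circuitCoeff_cast_ne_zero_iff hlam hp hC i).2 hi
    (MvPolynomial.C_injective _ _ (h1.symm.trans (map_zero _).symm))

theorem exists_dual_vector (hp : IsGood b p) (T : Bases b) (i : Fin n) :
    ∃ v : Fin k → ZMod p, ∀ j ∈ T.1, ∑ r, (b j r : ZMod p) * v r = if j = i then 1 else 0 := by
  have hT : IsIndep (ZMod p) b T.1 := (hp.2 _).1 T.2.2
  have h1 : LinearIndepOn (ZMod p) (gVec (ZMod p) b) (Set.range T.enum) := by
    rw [T.range_enum]
    exact hT
  rw [linearIndepOn_range_iff T.enum_injective] at h1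
  let M : Matrix (Fin k) (Fin k) (ZMod p) := Matrix.of fun m r => (b (T.enum m) r : ZMod p)
  have hM : IsUnit M := Matrix.linearIndependent_rows_iff_isUnit.1 h1
  have hdet := (Matrix.isUnit_iff_isUnit_det M).1 hM
  refine ⟨M⁻¹.mulVec fun m => if T.enum m = i then 1 else 0, fun j hj => ?_⟩
  rw [← Finset.mem_coe, ← T.range_enum] at hj
  obtain ⟨m, rfl⟩ := hj
  have h2 : M.mulVec (M⁻¹.mulVec fun m => if T.enum m = i then 1 else 0) =
      fun m => if T.enum m = i then (1 : ZMod p) else 0 := by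
    rw [Matrix.mulVec_mulVec, Matrix.mul_nonsing_inv _ hdet, Matrix.one_mulVec]
  exact congrFun h2 m

end Circuits

/-! ### Matrix entries of the circuit operators -/

section CircuitOperator

variable {n k : ℕ} {b : Fin n → Fin k → ℤ} {R : Type*} [CommRing R]

theorem mem_swapTuple {C S : Finset (Fin n)} {i j : Fin n} :
    j ∈ swapTuple C S i ↔ j ∈ C.erase i ∨ j ∈ S := by
  rw [swapTuple, List.mem_append, Finset.mem_sort, Finset.mem_sort]

theorem sdiff_and_inter_of_flagCoeff_ne_zero {C S : Finset (Fin n)} (hS : Disjoint C S) {i : Fin n}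
    {T : Bases b} (h : flagCoeff (swapTuple C S i) T ≠ 0) :
    T.1 \ C = S ∧ T.1 ∩ C = C.erase i := by
  have hm := fun j => (mem_iff_of_flagCoeff_ne_zero h j).symm.trans mem_swapTuple
  have hd : ∀ j ∈ C, j ∉ S := fun j hj => Finset.disjoint_left.1 hS hj
  constructor
  · ext j
    have := hm j
    have := hd j
    grind
  · ext j
    have := hm j
    have := hd j
    grind

/-- Passes from the columns of `L_C` to its rows, so that the coordinates of `I` entering the entry
at `T` appear as one alternating sum over `C`. -/
theorem circuitOp_apply (a : Fin n → R) (C : Finset (Fin n)) (I : Space b R) (T : Bases b) :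
    circuitOp b a C I T = ∑ l ∈ C, if T.1 ∩ C = C.erase l then
      (flagCoeff (swapTuple C (T.1 \ C) l) T : R) * (-1) ^ pos C l * a l *
        ∑ i ∈ C, (-1) ^ pos C i * coord I (swapTuple C (T.1 \ C) i) else 0 := by
  -- Nonzero flag coefficients already force `T' \ C = T \ C` and both intersection conditions, so
  -- the test on `T'` can be traded for the one on `T`.
  have hterm : ∀ (T' : Bases b) (i l : Fin n),
      (if T'.1 ∩ C = C.erase i then
        I T' * ((flagCoeff (swapTuple C (T'.1 \ C) i) T' : R) * (-1) ^ pos C i) *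
          (((-1) ^ pos C l * a l) * (flagCoeff (swapTuple C (T'.1 \ C) l) T : R)) else 0) =
      if T.1 ∩ C = C.erase l then
        (flagCoeff (swapTuple C (T.1 \ C) l) T : R) * (-1) ^ pos C l * a l *
          ((-1) ^ pos C i * ((flagCoeff (swapTuple C (T.1 \ C) i) T' : R) * I T')) else 0 := by
    intro T' i l
    by_cases hS : T'.1 \ C = T.1 \ C
    · rw [hS]
      by_cases h1 : flagCoeff (swapTuple C (T.1 \ C) i) T' = 0
      · simp [h1]
      by_cases h2 : flagCoeff (swapTuple C (T.1 \ C) l) T = 0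
      · simp [h2]
      rw [if_pos (sdiff_and_inter_of_flagCoeff_ne_zero Finset.disjoint_sdiff h1).2,
        if_pos (sdiff_and_inter_of_flagCoeff_ne_zero Finset.disjoint_sdiff h2).2]
      ring
    · have h1 : flagCoeff (swapTuple C (T.1 \ C) i) T' = 0 := by
        by_contra h
        exact hS (sdiff_and_inter_of_flagCoeff_ne_zero Finset.disjoint_sdiff h).1
      have h2 : flagCoeff (swapTuple C (T'.1 \ C) l) T = 0 := by
        by_contra h
        exact hS (sdiff_and_inter_of_flagCoeff_ne_zero Finset.disjoint_sdiff h).1.symm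
      simp [h1, h2]
  have hL : circuitOp b a C I T = ∑ T' : Bases b, ∑ i ∈ C, ∑ l ∈ C,
      (if T'.1 ∩ C = C.erase i then
        I T' * ((flagCoeff (swapTuple C (T'.1 \ C) i) T' : R) * (-1) ^ pos C i) *
          (((-1) ^ pos C l * a l) * (flagCoeff (swapTuple C (T'.1 \ C) l) T : R)) else 0) := by
    rw [circuitOp, Module.Basis.constr_apply_fintype, Finset.sum_apply]
    refine Finset.sum_congr rfl fun T' _ => ?_
    rw [circuitOpBasis, Pi.smul_apply, Finset.sum_apply, smul_eq_mul, Finset.mul_sum]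
    refine Finset.sum_congr rfl fun i _ => ?_
    split_ifs
    · rw [Pi.smul_apply, Finset.sum_apply, smul_eq_mul, ← mul_assoc, Finset.mul_sum]
      rfl
    · simp
  have hR : ∀ l ∈ C, (if T.1 ∩ C = C.erase l then
      (flagCoeff (swapTuple C (T.1 \ C) l) T : R) * (-1) ^ pos C l * a l *
        ∑ i ∈ C, (-1) ^ pos C i * coord I (swapTuple C (T.1 \ C) i) else 0) =
      ∑ i ∈ C, ∑ T' : Bases b, if T.1 ∩ C = C.erase l then
        (flagCoeff (swapTuple C (T.1 \ C) l) T : R) * (-1) ^ pos C l * a l *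
          ((-1) ^ pos C i * ((flagCoeff (swapTuple C (T.1 \ C) i) T' : R) * I T')) else 0 := by
    intro l _
    split_ifs
    · simp only [coord, Finset.mul_sum]
    · simp
  rw [hL, Finset.sum_congr rfl hR]
  simp only [hterm]
  rw [Finset.sum_comm]
  simp only [Finset.sum_comm (s := (Finset.univ : Finset (Bases b))) (t := C)]
  rw [Finset.sum_comm]

end CircuitOperator

/-! ### Singular-vector equations -/

section Solution

variable {n k : ℕ} {b : Fin n → Fin k → ℤ} {p : ℕ} [Fact p.Prime]

theorem lowerExp_sub_single (A : Fin n → ℕ) {S : Finset (Fin n)} {l : Fin n} (hl : l ∉ S) :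
    lowerExp A S - Pi.single l 1 = lowerExp A (insert l S) := by
  ext j
  by_cases hj : j = l
  · subst hj
    simp [lowerExp, hl]
  · simp [lowerExp, hj]

theorem lowerExp_erase {A : Fin n → ℕ} (hA : ∀ j, 0 < A j) {S : Finset (Fin n)} {l : Fin n}
    (hl : l ∈ S) : lowerExp A (S.erase l) = lowerExp A S + Pi.single l 1 := by
  ext j
  by_cases hj : j = l
  · subst hj
    have := hA j
    simp only [lowerExp, Finset.mem_erase, ne_eq, not_true_eq_false, false_and, if_false, hl,
      if_true, Pi.add_apply, Pi.single_eq_same]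
    omega
  · simp [lowerExp, hj]

theorem intCast_eq_mul {a κ : ℤ} {m : ℕ} (hκ : (κ : ZMod p) ≠ 0)
    (h : (m : ZMod p) = (a : ZMod p) / (κ : ZMod p)) :
    (a : MvPolynomial (Fin n) (ZMod p)) = κ * m := by
  have h1 : (a : ZMod p) = κ * m := by
    rw [h, mul_div_cancel₀ _ hκ]
  have := congrArg (MvPolynomial.C (σ := Fin n)) h1
  simpa using this

theorem isSingular_solutionVec (hk : 0 < k) (A : Fin n → ℕ) (q : Fin k → ℤ) (e : Fin k →₀ ℕ)
    (he : ∀ r, ((e r + 1 : ℕ) : ZMod p) = 0) {a : Fin n → ℤ} {κ : ℤ}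
    (ha : ∀ j, (a j : MvPolynomial (Fin n) (ZMod p)) = κ * A j) :
    IsSingular (fun j => (a j : MvPolynomial (Fin n) (ZMod p))) (solutionVec p b A q e) := by
  obtain ⟨k, rfl⟩ : ∃ k', k = k' + 1 := ⟨k - 1, by omega⟩
  intro s
  change Fin k → Fin n at s
  change ∑ j, (a j : MvPolynomial (Fin n) (ZMod p)) *
    coord (solutionVec p b A q e) (j :: List.ofFn (n := k) s) = 0
  set S := Finset.univ.image s
  -- The cofactors along the column of `j`: they do not depend on `j`, so they serve as multipliers
  -- of the Stokes relations.
  let c : Fin (k + 1) → ℤ := fun r =>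
    (-1) ^ (r : ℕ) * Matrix.det (Matrix.of fun i l : Fin k => b (s i) (r.succAbove l))
  have hdet : ∀ j, minorDet b (Fin.cons j s : Fin (k + 1) → Fin n) = ∑ r, b j r * c r := by
    intro j
    rw [minorDet, Matrix.det_succ_column_zero]
    refine Finset.sum_congr rfl fun r _ => ?_
    rw [← Matrix.det_transpose (Matrix.submatrix _ _ _)]
    simp only [c, Matrix.of_apply, Fin.cons_zero]
    rw [mul_comm ((-1) ^ (r : ℕ)) (b j r), mul_assoc]
    congr 3
  have hzero : ∀ j ∈ S, minorDet b (Fin.cons j s : Fin (k + 1) → Fin n) = 0 := by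
    intro j hj
    obtain ⟨m, _, rfl⟩ := Finset.mem_image.1 hj
    exact Matrix.det_zero_of_column_eq (i := 0) (j := m.succ) (Fin.succ_ne_zero m).symm
      fun r => by simp
  have hcoord : ∀ j, coord (solutionVec p b A q e) (j :: List.ofFn s) =
      (minorDet b (Fin.cons j s : Fin (k + 1) → Fin n) : MvPolynomial (Fin n) (ZMod p)) *
        taylorProd p b q e (lowerExp A (insert j S)) := by
    intro j
    have h1 : j :: List.ofFn s = List.ofFn (Fin.cons j s : Fin (k + 1) → Fin n) := by
      rw [List.ofFn_succ]
      simp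
    have h2 : Finset.univ.image (Fin.cons j s : Fin (k + 1) → Fin n) = insert j S := by
      ext x
      simp [S, Fin.exists_fin_succ, eq_comm]
    rw [h1, coord_solutionVec, h2]
  have hsum : ∑ r, (c r : MvPolynomial (Fin n) (ZMod p)) *
      ∑ l, (b l r : MvPolynomial (Fin n) (ZMod p)) *
        ((lowerExp A S l : MvPolynomial (Fin n) (ZMod p)) * taylorProd p b q e (lowerExp A S - Pi.single l 1)) = 0 :=
    Finset.sum_eq_zero fun r _ => by
      rw [sum_mul_taylorProd_sub p b q e r (he r), mul_zero]
  simp only [Finset.mul_sum] at hsum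
  rw [Finset.sum_comm] at hsum
  have hterm : ∀ j, (a j : MvPolynomial (Fin n) (ZMod p)) *
      coord (solutionVec p b A q e) (j :: List.ofFn s) =
      κ * ∑ r, (c r : MvPolynomial (Fin n) (ZMod p)) *
        ((b j r : MvPolynomial (Fin n) (ZMod p)) *
          ((lowerExp A S j : MvPolynomial (Fin n) (ZMod p)) * taylorProd p b q e (lowerExp A S - Pi.single j 1))) := by
    intro j
    have h1 : ∑ r, (c r : MvPolynomial (Fin n) (ZMod p)) *
        ((b j r : MvPolynomial (Fin n) (ZMod p)) *
          ((lowerExp A S j : MvPolynomial (Fin n) (ZMod p)) * taylorProd p b q e (lowerExp A S - Pi.single j 1))) =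
        (minorDet b (Fin.cons j s : Fin (k + 1) → Fin n) : MvPolynomial (Fin n) (ZMod p)) *
          ((lowerExp A S j : MvPolynomial (Fin n) (ZMod p)) * taylorProd p b q e (lowerExp A S - Pi.single j 1)) := by
      rw [hdet, Int.cast_sum, Finset.sum_mul]
      refine Finset.sum_congr rfl fun r _ => ?_
      rw [Int.cast_mul (b j r) (c r)]
      ring
    rw [h1, hcoord, ha]
    -- A repeated index kills the minor; otherwise the exponent at `j` is the full `A j`, which
    -- supplies `a j = κ A j`.
    by_cases hj : j ∈ S
    · rw [hzero j hj]
      simp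
    · have : lowerExp A S j = A j := by simp [lowerExp, hj]
      rw [lowerExp_sub_single A hj, this]
      ring
  simp only [hterm]
  rw [← Finset.mul_sum, hsum, mul_zero]

/-! ### Gauss-Manin equations -/

variable {lam : Finset (Fin n) → Fin n → ℤ}

/-- The fundamental circuit relation for the coordinates of the solution. -/
theorem circuitCoeff_mul_sum_coord (hlam : IsCircuitCoeff b lam) {A : Fin n → ℕ}
    (hA : ∀ j, 0 < A j) (q : Fin k → ℤ) (e : Fin k →₀ ℕ) (T : Bases b) {C : Finset (Fin n)}
    (hC : C ∈ circuits b) {l : Fin n} (hl : l ∈ C) (hT : T.1 ∩ C = C.erase l) :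
    (lam C l : MvPolynomial (Fin n) (ZMod p)) *
      ((flagCoeff (swapTuple C (T.1 \ C) l) T : MvPolynomial (Fin n) (ZMod p)) * (-1) ^ pos C l *
        ∑ i ∈ C, (-1) ^ pos C i * coord (solutionVec p b A q e) (swapTuple C (T.1 \ C) i)) =
      circuitForm p lam C * ((minorDet b T.enum : MvPolynomial (Fin n) (ZMod p)) *
        taylorProd p b q e (lowerExp A (insert l T.1))) := by
  have hcard : C.card + (T.1 \ C).card = k + 1 := by
    have h1 := Finset.card_inter_add_card_sdiff T.1 C
    rw [hT, T.2.1] at h1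
    have h2 := Finset.card_erase_add_one hl
    omega
  obtain ⟨u, hu, hru, hsw⟩ := exists_swapTuple_eq (k := k) C (T.1 \ C) Finset.disjoint_sdiff hcard
  have hun : C ∪ T.1 \ C = insert l T.1 := by
    ext j
    have := Finset.ext_iff.1 hT j
    simp only [Finset.mem_inter, Finset.mem_erase] at this
    simp only [Finset.mem_union, Finset.mem_sdiff, Finset.mem_insert]
    by_cases hj : j = l
    · subst hj
      simp [hl]
    · tauto
  rw [hun] at hru
  choose! m hmpos hum hswm using hsw
  have hrel : ∀ r, ∑ x, lam C (u x) * b (u x) r = 0 := by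
    intro r
    rw [← (hlam C hC).2.1 r]
    refine Fintype.sum_of_injective u hu _ (fun j => lam C j * b j r) (fun j hj => ?_)
      fun _ => rfl
    have : j ∉ C := fun h => hj ((hru j).2 (hun ▸ Finset.mem_union_left _ h))
    rw [(hlam C hC).1 j this, zero_mul]
  have himage : ∀ i ∈ C, Finset.univ.image (fun x => u ((m i).succAbove x)) =
      (insert l T.1).erase i := by
    intro i hi
    ext j
    rw [Finset.mem_erase, ← hru]
    simp only [Finset.mem_image, Finset.mem_univ, true_and, Set.mem_range]
    constructor
    · rintro ⟨x, rfl⟩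
      refine ⟨fun h => ?_, _, rfl⟩
      exact Fin.succAbove_ne _ _ (hu (h.trans (hum i hi).symm))
    · rintro ⟨hji, y, rfl⟩
      have hy : y ≠ m i := fun h => hji (by rw [h, hum i hi])
      obtain ⟨x, hx⟩ := Fin.exists_succAbove_eq hy
      exact ⟨x, by rw [hx]⟩
  -- Cramer's rule: it replaces each signed minor by `λ_C^i` times a fixed one, which makes the sum
  -- over `C` an instance of `sum_mul_taylorProd_add`.
  have hcr : ∀ i ∈ C, lam C l * ((-1) ^ pos C i * minorDet b (fun x => u ((m i).succAbove x))) =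
      lam C i * ((-1) ^ pos C l * minorDet b (fun x => u ((m l).succAbove x))) := by
    intro i hi
    have := mul_minorDet_succAbove u (fun x => lam C (u x)) hrel (m l) (m i)
    simpa only [hum i hi, hum l hl, hmpos i hi, hmpos l hl] using this
  have hsum : (lam C l : MvPolynomial (Fin n) (ZMod p)) *
      ∑ i ∈ C, (-1) ^ pos C i * coord (solutionVec p b A q e) (swapTuple C (T.1 \ C) i) =
      circuitForm p lam C * (((-1) ^ pos C l * minorDet b (fun x => u ((m l).succAbove x)) : ℤ) *
        taylorProd p b q e (lowerExp A (insert l T.1))) := by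
    have h1 : circuitForm p lam C = ∑ i, (lam C i : MvPolynomial (Fin n) (ZMod p)) *
        MvPolynomial.X i := by
      simp [circuitForm]
    have h2 := sum_mul_taylorProd_add p b q e (lam C) (hlam C hC).2.1 (lowerExp A (insert l T.1))
    rw [h1, mul_left_comm, ← h2, Finset.mul_sum, Finset.mul_sum]
    rw [← Finset.sum_subset (Finset.subset_univ C) fun j _ hj => by
      rw [(hlam C hC).1 j hj]; simp]
    refine Finset.sum_congr rfl fun i hi => ?_
    have hi' : i ∈ insert l T.1 := hun ▸ Finset.mem_union_left _ hi
    rw [hswm i hi, coord_solutionVec, himage i hi, lowerExp_erase hA hi']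
    have h3 := congrArg (Int.cast (R := MvPolynomial (Fin n) (ZMod p))) (hcr i hi)
    push_cast at h3 ⊢
    linear_combination taylorProd p b q e (lowerExp A (insert l T.1) + Pi.single i 1) * h3
  have hflag : flagCoeff (swapTuple C (T.1 \ C) l) T ≠ 0 := by
    rw [hswm l hl]
    refine flagCoeff_ne_zero (fun x y h => Fin.succAbove_right_injective (hu h)) ?_
    have hlT : l ∉ T.1 := fun h => by
      have := hT ▸ Finset.mem_inter.2 ⟨h, hl⟩
      simp at this
    rw [himage l hl, Finset.erase_insert hlT]
  rw [hswm l hl] at hflag ⊢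
  have hd := congrArg (Int.cast (R := MvPolynomial (Fin n) (ZMod p)))
    (flagCoeff_mul_minorDet hflag)
  rw [mul_left_comm, hsum, ← hd]
  push_cast
  have hsq : ((-1) ^ pos C l * (-1) ^ pos C l : MvPolynomial (Fin n) (ZMod p)) = 1 := by
    rw [← mul_pow]
    simp
  linear_combination (flagCoeff (List.ofFn fun x => u ((m l).succAbove x)) T *
    circuitForm p lam C * minorDet b (fun x => u ((m l).succAbove x)) *
    taylorProd p b q e (lowerExp A (insert l T.1))) * hsq

/-- The derivatives of the solution in terms of the expansions of the `g_l`, `l ∉ T`, in the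
basis `T`: `ρ l` is the coefficient of `-g_i` for `i ∈ T`. -/
theorem kappa_mul_pderiv_solutionVec (hlam : IsCircuitCoeff b lam) (hp : IsGood b p)
    {A : Fin n → ℕ} (q : Fin k → ℤ) (e : Fin k →₀ ℕ)
    (he : ∀ r, ((e r + 1 : ℕ) : ZMod p) = 0) {a : Fin n → ℤ} {κ : ℤ}
    (ha : ∀ j, (a j : MvPolynomial (Fin n) (ZMod p)) = κ * A j) (T : Bases b) (i : Fin n)
    (D : Fin n → Finset (Fin n)) (hD : ∀ l ∉ T.1, D l ∈ circuits b)
    (hlD : ∀ l ∉ T.1, l ∈ D l) (hTD : ∀ l ∉ T.1, T.1 ∩ D l = (D l).erase l) :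
    (κ : MvPolynomial (Fin n) (ZMod p)) * MvPolynomial.pderiv i (solutionVec p b A q e T) =
      ∑ l, if l ∈ T.1 then 0 else
        MvPolynomial.C ((lam (D l) i : ZMod p) / lam (D l) l) * ((a l : MvPolynomial (Fin n) (ZMod p)) *
          ((minorDet b T.enum : MvPolynomial (Fin n) (ZMod p)) *
            taylorProd p b q e (lowerExp A (insert l T.1)))) := by
  set d : MvPolynomial (Fin n) (ZMod p) := (minorDet b T.enum : MvPolynomial (Fin n) (ZMod p))
  have hlhs : MvPolynomial.pderiv i (solutionVec p b A q e T) =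
      d * ((lowerExp A T.1 i : MvPolynomial (Fin n) (ZMod p)) * taylorProd p b q e (lowerExp A T.1 - Pi.single i 1)) := by
    rw [solutionVec_eq, Derivation.leibniz, Derivation.map_intCast, smul_zero, add_zero,
      smul_eq_mul]
    congr 1
    exact pderiv_taylorProd p b q e i (lowerExp A T.1)
  have hlamne : ∀ l ∉ T.1, (lam (D l) l : ZMod p) ≠ 0 := fun l hl =>
    (circuitCoeff_cast_ne_zero_iff hlam hp (hD l hl) l).2 (hlD l hl)
  rw [hlhs]
  by_cases hi : i ∈ T.1
  -- For `i ∈ T`, contracting the Stokes relations with `v` replaces `b_l` by `g_l(v)`, which leaves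
  -- only `l = i` and the `l ∉ T`. Evaluating the relation of `D l` at `v` gives `λ^l g_l(v) + λ^i =
  -- 0`.
  · obtain ⟨v, hv⟩ := exists_dual_vector hp T i
    have hρ : ∀ l ∉ T.1, (lam (D l) i : ZMod p) / lam (D l) l = -∑ r, (b l r : ZMod p) * v r := by
      intro l hl
      have h1 : ∑ j, (lam (D l) j : ZMod p) * ∑ r, (b j r : ZMod p) * v r = 0 := by
        simp only [Finset.mul_sum]
        rw [Finset.sum_comm]
        refine Finset.sum_eq_zero fun r _ => ?_
        simp only [← mul_assoc]
        rw [← Finset.sum_mul, sum_circuitCoeff_cast hlam (hD l hl), zero_mul]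
      have h2 : ∀ j, (lam (D l) j : ZMod p) * ∑ r, (b j r : ZMod p) * v r =
          (if j = l then (lam (D l) l : ZMod p) * ∑ r, (b l r : ZMod p) * v r else 0) +
            if j = i then (lam (D l) i : ZMod p) else 0 := by
        intro j
        by_cases hjl : j = l
        · subst hjl
          have : j ≠ i := fun h => hl (h ▸ hi)
          simp [this]
        · by_cases hjT : j ∈ T.1
          · rw [hv j hjT, if_neg hjl, zero_add]
            by_cases hji : j = i
            · subst hji
              simp
            · simp [hji]
          · have hjD : j ∉ D l := fun h =>
              hjT (Finset.mem_inter.1 (hTD l hl ▸ Finset.mem_erase.2 ⟨hjl, h⟩)).1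
            have hji : j ≠ i := fun h => hjT (h ▸ hi)
            rw [(hlam _ (hD l hl)).1 j hjD]
            simp [hjl, hji]
      rw [Finset.sum_congr rfl fun j _ => h2 j] at h1
      simp only [Finset.sum_add_distrib, Finset.sum_ite_eq', Finset.mem_univ, if_true] at h1
      have := hlamne l hl
      field_simp
      linear_combination h1
    have hsum : ∑ r, MvPolynomial.C (v r) *
        ∑ l, (b l r : MvPolynomial (Fin n) (ZMod p)) *
          ((lowerExp A T.1 l : MvPolynomial (Fin n) (ZMod p)) * taylorProd p b q e (lowerExp A T.1 - Pi.single l 1)) = 0 :=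
      Finset.sum_eq_zero fun r _ => by
        rw [sum_mul_taylorProd_sub p b q e r (he r), mul_zero]
    simp only [Finset.mul_sum] at hsum
    rw [Finset.sum_comm] at hsum
    have hterm : ∀ l, (κ : MvPolynomial (Fin n) (ZMod p)) * d * ∑ r, MvPolynomial.C (v r) *
        ((b l r : MvPolynomial (Fin n) (ZMod p)) *
          ((lowerExp A T.1 l : MvPolynomial (Fin n) (ZMod p)) * taylorProd p b q e (lowerExp A T.1 - Pi.single l 1))) =
        (if l = i then (κ : MvPolynomial (Fin n) (ZMod p)) * (d *
          ((lowerExp A T.1 i : MvPolynomial (Fin n) (ZMod p)) * taylorProd p b q e (lowerExp A T.1 - Pi.single i 1))) else 0) -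
        if l ∈ T.1 then 0 else
        MvPolynomial.C ((lam (D l) i : ZMod p) / lam (D l) l) * ((a l : MvPolynomial (Fin n) (ZMod p)) *
          (d * taylorProd p b q e (lowerExp A (insert l T.1)))) := by
      intro l
      have h1 : ∑ r, MvPolynomial.C (v r) *
          ((b l r : MvPolynomial (Fin n) (ZMod p)) *
            ((lowerExp A T.1 l : MvPolynomial (Fin n) (ZMod p)) * taylorProd p b q e (lowerExp A T.1 - Pi.single l 1))) =
          MvPolynomial.C (∑ r, (b l r : ZMod p) * v r) *
            ((lowerExp A T.1 l : MvPolynomial (Fin n) (ZMod p)) * taylorProd p b q e (lowerExp A T.1 - Pi.single l 1)) := by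
        rw [map_sum, Finset.sum_mul]
        refine Finset.sum_congr rfl fun r _ => ?_
        rw [map_mul, map_intCast]
        ring
      rw [h1]
      by_cases hl : l ∈ T.1
      · rw [hv l hl, if_pos hl, sub_zero]
        by_cases hli : l = i
        · subst hli
          simp only [if_true, map_one]
          ring
        · simp [hli]
      · have hli : l ≠ i := fun h => hl (h ▸ hi)
        have h2 : lowerExp A T.1 l = A l := by simp [lowerExp, hl]
        rw [if_neg hl, if_neg hli, hρ l hl, ha, h2, lowerExp_sub_single A hl, map_neg]
        ring
    have h0 := Finset.sum_congr rfl fun l (_ : l ∈ Finset.univ) => hterm l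
    rw [← Finset.mul_sum, hsum, mul_zero, Finset.sum_sub_distrib, Finset.sum_ite_eq',
      if_pos (Finset.mem_univ i)] at h0
    exact sub_eq_zero.1 h0.symm
  -- For `i ∉ T`, the circuit `D l ⊆ T ∪ {l}` contains `i` only when `l = i`, and that term has
  -- ratio one.
  · rw [Finset.sum_eq_single i]
    · have h2 : lowerExp A T.1 i = A i := by simp [lowerExp, hi]
      rw [if_neg hi, div_self (hlamne i hi), map_one, h2, lowerExp_sub_single A hi, ha]
      ring
    · intro l _ hli
      split_ifs with hl
      · rfl
      · have hiD : i ∉ D l := fun h =>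
          hi (Finset.mem_inter.1 (hTD l hl ▸ Finset.mem_erase.2 ⟨hli.symm, h⟩)).1
        rw [(hlam _ (hD l hl)).1 i hiD]
        simp
    · simp

theorem coord_map {R S : Type*} [CommRing R] [CommRing S] (f : R →+* S) (I : Space b R)
    (s : List (Fin n)) : coord (fun T => f (I T)) s = f (coord I s) := by
  simp [coord]

/-- The sum over circuits becomes a sum over `l ∉ T`: for each such `l`, exactly one circuit
satisfies `l ∈ C` and `T ∩ C = C - l`. -/
theorem hamiltonian_solutionVec (hlam : IsCircuitCoeff b lam) (hp : IsGood b p)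
    {A : Fin n → ℕ} (hA : ∀ j, 0 < A j) (q : Fin k → ℤ) (e : Fin k →₀ ℕ) (a : Fin n → ℤ)
    (T : Bases b) (i : Fin n)
    (D : Fin n → Finset (Fin n)) (hD : ∀ l ∉ T.1, D l ∈ circuits b)
    (hlD : ∀ l ∉ T.1, l ∈ D l) (hTD : ∀ l ∉ T.1, T.1 ∩ D l = (D l).erase l) :
    hamiltonian p b lam a i
        (fun T => algebraMap _ (RatFun n p) (solutionVec p b A q e T)) T =
      algebraMap _ (RatFun n p) (∑ l, if l ∈ T.1 then 0 else
        MvPolynomial.C ((lam (D l) i : ZMod p) / lam (D l) l) * ((a l : MvPolynomial (Fin n) (ZMod p)) *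
          ((minorDet b T.enum : MvPolynomial (Fin n) (ZMod p)) *
            taylorProd p b q e (lowerExp A (insert l T.1))))) := by
  set φ := algebraMap (MvPolynomial (Fin n) (ZMod p)) (RatFun n p)
  let t : Finset (Fin n) → Fin n → MvPolynomial (Fin n) (ZMod p) := fun C l =>
    MvPolynomial.C ((lam C i : ZMod p) / lam C l) * ((a l : MvPolynomial (Fin n) (ZMod p)) *
          ((minorDet b T.enum : MvPolynomial (Fin n) (ZMod p)) *
            taylorProd p b q e (lowerExp A (insert l T.1))))
  have hterm : ∀ C ∈ circuits b, ((lam C i : RatFun n p) / φ (circuitForm p lam C)) *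
      circuitOp b (fun j => (a j : RatFun n p)) C (fun T => φ (solutionVec p b A q e T)) T =
      ∑ l, if l ∈ C ∧ T.1 ∩ C = C.erase l then φ (t C l) else 0 := by
    intro C hC
    rw [circuitOp_apply, Finset.mul_sum]
    rw [← Finset.sum_subset (Finset.subset_univ C) fun l _ hl => if_neg fun h => hl h.1]
    refine Finset.sum_congr rfl fun l hl => ?_
    by_cases hT : T.1 ∩ C = C.erase l
    · rw [if_pos hT, if_pos ⟨hl, hT⟩]
      simp only [coord_map]
      have h1 := congrArg φ (circuitCoeff_mul_sum_coord (p := p) hlam hA q e T hC hl hT)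
      have hf : φ (circuitForm p lam C) ≠ 0 := fun h =>
        circuitForm_ne_zero hlam hp hC hl
          (IsFractionRing.injective _ (RatFun n p) (h.trans (map_zero φ).symm))
      have hl0 := (circuitCoeff_cast_ne_zero_iff hlam hp hC l).2 hl
      have hc : ∀ m : ℤ, φ (MvPolynomial.C (m : ZMod p)) = (m : RatFun n p) := fun m => by simp
      have hl1 : (lam C l : RatFun n p) ≠ 0 := by
        rw [← hc]
        intro h
        have := IsFractionRing.injective _ (RatFun n p) (h.trans (map_zero φ).symm)
        exact hl0 (MvPolynomial.C_injective _ _ (this.trans (map_zero _).symm))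
      have hq : φ (MvPolynomial.C ((lam C i : ZMod p) / lam C l)) =
          (lam C i : RatFun n p) / lam C l := by
        have := map_div₀ ((φ.comp (MvPolynomial.C : ZMod p →+* _))) (lam C i : ZMod p) (lam C l)
        simpa only [RingHom.comp_apply, hc] using this
      simp only [t]
      rw [map_mul, hq]
      simp only [map_mul, map_intCast, map_sum, map_pow, map_neg, map_one] at h1 ⊢
      field_simp
      linear_combination (lam C i : RatFun n p) * (a l : RatFun n p) * h1
    · rw [if_neg hT, if_neg fun h => hT h.2, mul_zero]
  have hH : hamiltonian p b lam a i (fun T => φ (solutionVec p b A q e T)) T =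
      ∑ C ∈ circuits b, ((lam C i : RatFun n p) / φ (circuitForm p lam C)) *
      circuitOp b (fun j => (a j : RatFun n p)) C (fun T => φ (solutionVec p b A q e T)) T := by
    rw [hamiltonian, LinearMap.sum_apply, Finset.sum_apply]
    rfl
  rw [hH, Finset.sum_congr rfl hterm, Finset.sum_comm, map_sum]
  refine Finset.sum_congr rfl fun l _ => ?_
  by_cases hl : l ∈ T.1
  · rw [if_pos hl, map_zero]
    refine Finset.sum_eq_zero fun C _ => if_neg ?_
    rintro ⟨hlC, hTC⟩
    have := hTC ▸ Finset.mem_inter.2 ⟨hl, hlC⟩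
    simp at this
  · rw [if_neg hl, Finset.sum_eq_single (D l)]
    · rw [if_pos ⟨hlD l hl, hTD l hl⟩]
    · intro C hC hne
      refine if_neg ?_
      rintro ⟨hlC, hTC⟩
      exact hne (fundamental_circuit_unique hlam hp T hC hlC hTC (hD l hl) (hlD l hl) (hTD l hl))
    · exact fun h => absurd (hD l hl) h

theorem satisfiesGaussManin_solutionVec (hlam : IsCircuitCoeff b lam) (hp : IsGood b p)
    {A : Fin n → ℕ} (hA : ∀ j, 0 < A j) (q : Fin k → ℤ) (e : Fin k →₀ ℕ)
    (he : ∀ r, ((e r + 1 : ℕ) : ZMod p) = 0) {a : Fin n → ℤ} {κ : ℤ}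
    (ha : ∀ j, (a j : MvPolynomial (Fin n) (ZMod p)) = κ * A j) :
    SatisfiesGaussManin p b lam a κ (solutionVec p b A q e) := by
  intro i
  ext T
  choose! D hD hlD hTD using fun l (hl : l ∉ T.1) => exists_fundamental_circuit T hl
  rw [hamiltonian_solutionVec hlam hp hA q e a T i D hD hlD hTD,
    ← kappa_mul_pderiv_solutionVec hlam hp q e he ha T i D hD hlD hTD, map_mul, map_intCast]
  rfl

end Solution

end ParallelArr

theorem theorem4p4 (n k : ℕ) (hk : 0 < k) (hkn : k < n)
    (b : Fin n → Fin k → ℤ)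
    (hspan : Submodule.span ℂ (Set.range (ParallelArr.gVec ℂ b)) = ⊤)
    (lam : Finset (Fin n) → Fin n → ℤ) (hlam : ParallelArr.IsCircuitCoeff b lam)
    (p : ℕ) [Fact p.Prime] (hp : ParallelArr.IsGood b p)
    (a : Fin n → ℤ) (ha : ∀ j, a j ≠ 0)
    (κ : ℤ) (hκ : (κ : ZMod p) ≠ 0)
    (A : Fin n → ℕ) (hApos : ∀ j, 0 < A j) (hA : ∀ j, (A j : ZMod p) = (a j : ZMod p) / (κ : ZMod p))
    (q : Fin k → ℤ) (l : Fin k → ℕ) (hl : ∀ r, 0 < l r) :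
    let I : ParallelArr.Space b (MvPolynomial (Fin n) (ZMod p)) :=
      ParallelArr.solutionVec p b A q (Finsupp.equivFunOnFinite.symm fun r => l r * p - 1)
    ParallelArr.IsSingular (fun j => (a j : MvPolynomial (Fin n) (ZMod p))) I ∧
      ParallelArr.SatisfiesGaussManin p b lam a κ I := by
  -- Positivity of `l r * p` makes the truncated `l r * p - 1` an honest predecessor, so `e r + 1`
  -- is a multiple of `p`.
  have he : ∀ r,
      (((Finsupp.equivFunOnFinite.symm fun r => l r * p - 1) r + 1 : ℕ) : ZMod p) = 0 := by
    intro r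
    have h1 : 0 < l r * p := Nat.mul_pos (hl r) (Nat.Prime.pos Fact.out)
    have h2 : (Finsupp.equivFunOnFinite.symm fun r => l r * p - 1) r + 1 = l r * p := by
      rw [Finsupp.coe_equivFunOnFinite_symm]
      omega
    rw [h2, Nat.cast_mul, ZMod.natCast_self, mul_zero]
  have ha' := fun j => ParallelArr.intCast_eq_mul (n := n) hκ (hA j)
  exact ⟨ParallelArr.isSingular_solutionVec hk A q _ he ha',
    ParallelArr.satisfiesGaussManin_solutionVec hlam hp hApos q _ he ha'⟩
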